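/- **Theorem 4.2 (Nachtigall expansion).** Work in max algebra on $\mathbb R_+=[0,\infty)$: $a\oplus b=\max(a,b)$, $a\otimes b=ab$, extended to matrices in the usual way; all matrix products and powers below are max-algebraic, and $A^0=I$. *Notation.* For $A=(a_{ij})\in\mathbb R_+^{n\times n}$ let $\mathcal D(A)$ be the digraph on $N=\{1,\dots,n\}$ with an edge $(i,j)$ whenever $a_{ij}\ne0$. The weight $w(P)$ of a path is the product of the entries of $A$ along its edges (paths may repeat nodes). A cycle is a path of length at least $1$ with equal end nodes. Let $\lambda(A)$ be the maximum of $w(P)^{1/k}$ over all cycles $P$ of length $k\in\{1,\dots,n\}$ in $\mathcal D(A)$, and $\lambda(A)=0$ if there are none. The critical digraph $\mathcal C(A)$ consists of all nodes and edges of the cycles $P$ (of any length $k\geq 1$) with $w(P)^{1/k}=\lambda(A)$. A digraph is completely reducible if it is nonempty, there is no path between two different strongly connected components, and each of its nodes lies on a cycle. Its cyclicity is the l.c.m. over its strongly connected components of the g.c.d. of the lengths of all simple cycles in the component. The Kleene star is $A^*=I\oplus A\oplus A^2\oplus\cdots$. *Construction.* Let $A\in\mathbb R_+^{n\times n}$.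 For $\mu=1,2,\dots$ put $K_\mu=N\setminus\bigcup_{i=1}^{\mu-1}N_i$, let $A_\mu\in\mathbb R_+^{n\times n}$ be obtained from $A$ by replacing with $0$ all entries whose row or column index is not in $K_\mu$ (so $A_1=A$), and let $\lambda_\mu=\lambda(A_\mu)$. If $\lambda_\mu=0$, stop; otherwise select an arbitrary completely reducible (not necessarily induced) subdigraph $\mathcal C_\mu=(N_\mu,E_\mu)$ of $\mathcal C(A_\mu)$ and continue with $\mu+1$. Let $m$ be the last $\mu$ with $\lambda_\mu>0$ ($m=0$ if $\lambda(A)=0$). For $1\le\mu\le m$ let $\gamma_\mu$ be the cyclicity of $\mathcal C_\mu$ and $B_\mu=\big((A_\mu/\lambda_\mu)^{\gamma_\mu}\big)^*$. Let $C_\mu$ be $B_\mu$ with all columns outside $N_\mu$ replaced by $0$, let $R_\mu$ be $B_\mu$ with all rows outside $N_\mu$ replaced by $0$, and let $S_\mu$ be $A_\mu/\lambda_\mu$ with all entries outside $E_\mu$ replaced by $0$. *Claim.* For every $A\in\mathbb R_+^{n\times n}$ and every choice of the selected digraphs, the procedure stops with $m\le n$, all the Kleene stars $B_\mu$ ($1\le\mu\le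 m$) are finite, and for all integers $t\ge 3n^2$ and all $\mu\in\{1,\dots,m\}$ $$A_\mu^t=\bigoplus_{\nu=\mu}^m\lambda_\nu^t\,C_\nu S_\nu^tR_\nu .$$ In particular, $$A^t=\bigoplus_{\nu=1}^m\lambda_\nu^t\,C_\nu S_\nu^tR_\nu ,$$ where the right-hand side is the zero matrix if $m=0$. -/

import Mathlib

open scoped NNReal

noncomputable section

namespace MaxAlg

/-! ### Max-algebraic matrices: entries in `ℝ≥0`, addition is `max`, multiplication is the usual one -/

/-- Max-algebraic product: `(A ⊗ B) i j = max_k (A i k * B k j)`. -/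
def mul {n : ℕ} (A B : Matrix (Fin n) (Fin n) ℝ≥0) : Matrix (Fin n) (Fin n) ℝ≥0 :=
  Matrix.of fun i j => Finset.univ.sup fun k => A i k * B k j

/-- Max-algebraic power, with `A ^ 0` the identity matrix. -/
def pow {n : ℕ} (A : Matrix (Fin n) (Fin n) ℝ≥0) : ℕ → Matrix (Fin n) (Fin n) ℝ≥0
  | 0 => 1
  | t + 1 => mul (pow A t) A

/-- Max-algebraic sum `⊕_{ν ∈ s} F ν`, the entrywise maximum (the zero matrix if `s` is empty). -/
def sum {n : ℕ} (s : Finset ℕ) (F : ℕ → Matrix (Fin n) (Fin n) ℝ≥0) :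
    Matrix (Fin n) (Fin n) ℝ≥0 :=
  Matrix.of fun i j => s.sup fun ν => F ν i j

/-- The series `I ⊕ A ⊕ A² ⊕ …` converges to a finite matrix. -/
def StarFinite {n : ℕ} (A : Matrix (Fin n) (Fin n) ℝ≥0) : Prop :=
  ∀ i j, BddAbove (Set.range fun k : ℕ => pow A k i j)

/-- The Kleene star `A* = I ⊕ A ⊕ A² ⊕ …`; meaningful if `StarFinite A`. -/
def star {n : ℕ} (A : Matrix (Fin n) (Fin n) ℝ≥0) : Matrix (Fin n) (Fin n) ℝ≥0 :=
  Matrix.of fun i j => ⨆ k : ℕ, pow A k i j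

/-! ### Digraphs, paths, cycles -/

/-- A digraph `(N, E)` whose nodes are taken from `{1, …, n}` (represented by `Fin n`). -/
structure Graph (n : ℕ) where
  nodes : Finset (Fin n)
  edges : Finset (Fin n × Fin n)
  src_mem : ∀ e ∈ edges, e.1 ∈ nodes
  tgt_mem : ∀ e ∈ edges, e.2 ∈ nodes

/-- `G` is a subdigraph of `H` (not necessarily an induced one). -/
def Graph.IsSub {n : ℕ} (G H : Graph n) : Prop :=
  G.nodes ⊆ H.nodes ∧ G.edges ⊆ H.edges

/-- `p = (p 0, …, p k)` is a path of length `k` in `G`; nodes may be repeated. -/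
def Graph.IsPath {n : ℕ} (G : Graph n) {k : ℕ} (p : Fin (k + 1) → Fin n) : Prop :=
  (∀ i, p i ∈ G.nodes) ∧ ∀ i : Fin k, (p i.castSucc, p i.succ) ∈ G.edges

/-- A cycle: a path of length `k ≥ 1` whose end nodes coincide. -/
def Graph.IsCycle {n : ℕ} (G : Graph n) {k : ℕ} (p : Fin (k + 1) → Fin n) : Prop :=
  1 ≤ k ∧ G.IsPath p ∧ p 0 = p (Fin.last k)

/-- A simple cycle: no repeated node except that the last node is the first one. -/
def Graph.IsSimpleCycle {n : ℕ} (G : Graph n) {k : ℕ} (p : Fin (k + 1) → Fin n) : Prop :=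
  G.IsCycle p ∧ Function.Injective fun i : Fin k => p i.castSucc

/-- There is a path (possibly of length `0`) from `i` to `j` in `G`. -/
def Graph.Reaches {n : ℕ} (G : Graph n) (i j : Fin n) : Prop :=
  ∃ (k : ℕ) (p : Fin (k + 1) → Fin n), G.IsPath p ∧ p 0 = i ∧ p (Fin.last k) = j

/-- `i` and `j` lie in the same strongly connected component of `G`. -/
def Graph.SameComponent {n : ℕ} (G : Graph n) (i j : Fin n) : Prop :=
  G.Reaches i j ∧ G.Reaches j i

/-- `G` is completely reducible: it has at least one node, different strongly connected components
are not connected with each other, and every component is nontrivial, i.e. every node lies on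
a cycle. -/
def Graph.IsCompletelyReducible {n : ℕ} (G : Graph n) : Prop :=
  G.nodes.Nonempty ∧
  (∀ i j, G.Reaches i j → G.Reaches j i) ∧
  ∀ i ∈ G.nodes, ∃ (k : ℕ) (p : Fin (k + 1) → Fin n), G.IsCycle p ∧ p 0 = i

open Classical in
/-- The cyclicity of the strongly connected component of the node `i`: the g.c.d. of the lengths of
all simple cycles in that component (such lengths are at most `n`). -/
def Graph.componentCyclicity {n : ℕ} (G : Graph n) (i : Fin n) : ℕ :=
  ((Finset.Icc 1 n).filter fun k => ∃ p : Fin (k + 1) → Fin n,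
    G.IsSimpleCycle p ∧ ∀ l, G.SameComponent i (p l)).gcd id

/-- The cyclicity of `G`: the l.c.m. of the cyclicities of its components. -/
def Graph.cyclicity {n : ℕ} (G : Graph n) : ℕ :=
  G.nodes.lcm G.componentCyclicity

/-! ### The digraph of a matrix, its maximum cycle geometric mean, its critical digraph -/

/-- The digraph associated with `A`: all nodes, and an edge `(i, j)` whenever `A i j ≠ 0`. -/
def digraph {n : ℕ} (A : Matrix (Fin n) (Fin n) ℝ≥0) : Graph n where
  nodes := Finset.univ
  edges := Finset.univ.filter fun e => A e.1 e.2 ≠ 0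
  src_mem := fun _ _ => Finset.mem_univ _
  tgt_mem := fun _ _ => Finset.mem_univ _

/-- The weight of a path: the product of the weights of its edges. -/
def weight {n : ℕ} (A : Matrix (Fin n) (Fin n) ℝ≥0) {k : ℕ} (p : Fin (k + 1) → Fin n) : ℝ≥0 :=
  ∏ i : Fin k, A (p i.castSucc) (p i.succ)

open Classical in
/-- The maximum cycle geometric mean `λ(A)`: the maximum of `w(P) ^ (1 / k)` over all cycles `P` of
lengths `k = 1, …, n` in the digraph of `A`; it is `0` if there are no cycles. -/
def mcgm {n : ℕ} (A : Matrix (Fin n) (Fin n) ℝ≥0) : ℝ≥0 :=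
  (Finset.Icc 1 n).sup fun k =>
    (Finset.univ.filter fun p : Fin (k + 1) → Fin n => (digraph A).IsCycle p).sup fun p =>
      weight A p ^ (1 / (k : ℝ))

/-- A critical cycle: a cycle whose geometric mean is `λ(A)`. -/
def IsCriticalCycle {n : ℕ} (A : Matrix (Fin n) (Fin n) ℝ≥0) {k : ℕ}
    (p : Fin (k + 1) → Fin n) : Prop :=
  (digraph A).IsCycle p ∧ weight A p ^ (1 / (k : ℝ)) = mcgm A

open Classical in
/-- The critical digraph of `A`: all nodes and edges that belong to critical cycles. -/
def critical {n : ℕ} (A : Matrix (Fin n) (Fin n) ℝ≥0) : Graph n where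
  nodes := Finset.univ.filter fun v =>
    ∃ (k : ℕ) (p : Fin (k + 1) → Fin n), IsCriticalCycle A p ∧ ∃ i, p i = v
  edges := Finset.univ.filter fun e =>
    ∃ (k : ℕ) (p : Fin (k + 1) → Fin n), IsCriticalCycle A p ∧
      ∃ i : Fin k, (p i.castSucc, p i.succ) = e
  src_mem := by
    intro e he
    obtain ⟨k, p, hp, i, rfl⟩ := (Finset.mem_filter.mp he).2
    exact Finset.mem_filter.mpr ⟨Finset.mem_univ _, k, p, hp, _, rfl⟩
  tgt_mem := by
    intro e he
    obtain ⟨k, p, hp, i, rfl⟩ := (Finset.mem_filter.mp he).2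
    exact Finset.mem_filter.mpr ⟨Finset.mem_univ _, k, p, hp, _, rfl⟩

/-! ### CSR products

Below, `A` is a matrix with `λ(A) > 0` and `G = (N_c, E_c)` a completely reducible subdigraph of its
critical digraph; `A` is first divided by `λ(A)`. -/

/-- `A / λ(A)`. -/
def normalized {n : ℕ} (A : Matrix (Fin n) (Fin n) ℝ≥0) : Matrix (Fin n) (Fin n) ℝ≥0 :=
  Matrix.of fun i j => A i j / mcgm A

/-- `B = ((A / λ(A)) ^ γ)*`, where `γ` is the cyclicity of `G`. -/
def matB {n : ℕ} (A : Matrix (Fin n) (Fin n) ℝ≥0) (G : Graph n) : Matrix (Fin n) (Fin n) ℝ≥0 :=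
  star (pow (normalized A) G.cyclicity)

/-- `C`: the columns of `B` with indices in `N_c`, the other columns being zero. -/
def matC {n : ℕ} (A : Matrix (Fin n) (Fin n) ℝ≥0) (G : Graph n) : Matrix (Fin n) (Fin n) ℝ≥0 :=
  Matrix.of fun i j => if j ∈ G.nodes then matB A G i j else 0

/-- `R`: the rows of `B` with indices in `N_c`, the other rows being zero. -/
def matR {n : ℕ} (A : Matrix (Fin n) (Fin n) ℝ≥0) (G : Graph n) : Matrix (Fin n) (Fin n) ℝ≥0 :=
  Matrix.of fun i j => if i ∈ G.nodes then matB A G i j else 0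

/-- `S`: the entries of `A / λ(A)` on the edges of `G`, the other entries being zero. -/
def matS {n : ℕ} (A : Matrix (Fin n) (Fin n) ℝ≥0) (G : Graph n) : Matrix (Fin n) (Fin n) ℝ≥0 :=
  Matrix.of fun i j => if (i, j) ∈ G.edges then normalized A i j else 0

/-- The CSR product `C ⊗ S^t ⊗ R`. -/
def csr {n : ℕ} (A : Matrix (Fin n) (Fin n) ℝ≥0) (G : Graph n) (t : ℕ) :
    Matrix (Fin n) (Fin n) ℝ≥0 :=
  mul (mul (matC A G) (pow (matS A G) t)) (matR A G)

/-! ### The iterative removal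

`G 1, G 2, …` are the selected digraphs; `G 0` plays no role. -/

/-- `K_μ = N \ ⋃_{1 ≤ i < μ} N_i`. -/
def remaining {n : ℕ} (G : ℕ → Graph n) (μ : ℕ) : Finset (Fin n) :=
  Finset.univ \ (Finset.Ico 1 μ).biUnion fun i => (G i).nodes

/-- `A_μ`: the entries of `A` with both indices in `K_μ`, the other entries being zero. -/
def reduced {n : ℕ} (A : Matrix (Fin n) (Fin n) ℝ≥0) (G : ℕ → Graph n) (μ : ℕ) :
    Matrix (Fin n) (Fin n) ℝ≥0 :=
  Matrix.of fun i j => if i ∈ remaining G μ ∧ j ∈ remaining G μ then A i j else 0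

/-- The selections `G 1, G 2, …` are admissible: as long as `λ_μ = λ(A_μ) > 0`, the digraph `G μ` is
a completely reducible subdigraph of the critical digraph of `A_μ`. Nothing is required of `G μ`
after the procedure has stopped. -/
def IsSelection {n : ℕ} (A : Matrix (Fin n) (Fin n) ℝ≥0) (G : ℕ → Graph n) : Prop :=
  ∀ μ, 1 ≤ μ → 0 < mcgm (reduced A G μ) →
    (G μ).IsCompletelyReducible ∧ (G μ).IsSub (critical (reduced A G μ))

/-- The scaled term `λ_ν^t C_ν S_ν^t R_ν`. -/
def term {n : ℕ} (A : Matrix (Fin n) (Fin n) ℝ≥0) (G : ℕ → Graph n) (ν t : ℕ) :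
    Matrix (Fin n) (Fin n) ℝ≥0 :=
  mcgm (reduced A G ν) ^ t • csr (reduced A G ν) (G ν) t

end MaxAlg

end

/-!
Powers of a max-algebraic matrix are handled as maxima of weights of walks: `pow A k i j` is the
largest weight of a walk of length `k` from `i` to `j`. Let `A` be a matrix with `λ(A) > 0` and `G` a
completely reducible subdigraph of its critical digraph. After division by `λ(A)`, every closed walk
has weight at most `1`, and every closed walk inside `G` has weight exactly `1`, since the rest of a
critical cycle compensates each of its edges. The expansion rests on two comparisons.

* `pow_mul_pow_le_csr`: a walk of length `t` that meets `G` has at most the weight recorded in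
  `C S^t R`, because a long closed walk of `G` can be inserted at the meeting point without loss.
* `csr_le_pow_normalized`: conversely `C S^t R` is at most the `t`-th power if `t ≥ 2 n²`. Its entries
  are suprema of weights of walks that meet `G` in a node `x` and whose lengths are congruent to `t`
  modulo the cyclicity of `G`. If `s ≤ n` is the length of a cycle of `G` through `x`, inserting a
  closed walk of `G` at `x` makes the length congruent to `t` modulo `s`
  (`exists_closed_walk_length`); by the pigeonhole principle the parts before and after `x` shrink
  below `n s` steps without changing their residues modulo `s` (`exists_pow_le_of_closed_le_one`);
  copies of the cycle then fill the walk up to length exactly `t`.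

A walk in the digraph of `A_μ` either meets `N_μ` or survives in that of `A_{μ+1}`
(`pow_reduced_le`). Repeating this, each walk of length `t` is covered by the first term whose nodes it
meets, and after the last step no cycle is left, so that no walk of length `t ≥ n` remains.
-/

namespace MaxAlg

variable {n : ℕ}

/-! ### Max-algebraic products and powers -/

theorem mul_le_mul_apply (A B : Matrix (Fin n) (Fin n) ℝ≥0) (i x j : Fin n) :
    A i x * B x j ≤ mul A B i j :=
  Finset.le_sup (f := fun k => A i k * B k j) (Finset.mem_univ x)

theorem exists_mul_apply_eq (A B : Matrix (Fin n) (Fin n) ℝ≥0) (i j : Fin n) :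
    ∃ x, mul A B i j = A i x * B x j := by
  obtain ⟨x, -, hx⟩ := Finset.exists_mem_eq_sup Finset.univ ⟨i, Finset.mem_univ i⟩
    (fun k => A i k * B k j)
  exact ⟨x, hx⟩

theorem mul_assoc' (A B C : Matrix (Fin n) (Fin n) ℝ≥0) :
    mul (mul A B) C = mul A (mul B C) := by
  ext1 i j
  apply le_antisymm
  · obtain ⟨x, hx⟩ := exists_mul_apply_eq (mul A B) C i j
    obtain ⟨y, hy⟩ := exists_mul_apply_eq A B i x
    rw [hx, hy, mul_assoc]
    exact (mul_le_mul_right (mul_le_mul_apply B C y x j) _).trans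
      (mul_le_mul_apply A (mul B C) i y j)
  · obtain ⟨x, hx⟩ := exists_mul_apply_eq A (mul B C) i j
    obtain ⟨y, hy⟩ := exists_mul_apply_eq B C x j
    rw [hx, hy, ← mul_assoc]
    exact (mul_le_mul_left (mul_le_mul_apply A B i x y) _).trans
      (mul_le_mul_apply (mul A B) C i y j)

theorem mul_one' (A : Matrix (Fin n) (Fin n) ℝ≥0) : mul A 1 = A := by
  ext1 i j
  apply le_antisymm
  · obtain ⟨x, hx⟩ := exists_mul_apply_eq A 1 i j
    rw [hx]
    by_cases h : x = j
    · subst h; simp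
    · simp [Matrix.one_apply_ne h]
  · simpa using mul_le_mul_apply A 1 i j j

theorem one_mul' (A : Matrix (Fin n) (Fin n) ℝ≥0) : mul 1 A = A := by
  ext1 i j
  apply le_antisymm
  · obtain ⟨x, hx⟩ := exists_mul_apply_eq 1 A i j
    rw [hx]
    by_cases h : i = x
    · subst h; simp
    · simp [Matrix.one_apply_ne h]
  · simpa using mul_le_mul_apply 1 A i i j

theorem pow_one' (A : Matrix (Fin n) (Fin n) ℝ≥0) : pow A 1 = A := one_mul' A

theorem pow_add' (A : Matrix (Fin n) (Fin n) ℝ≥0) (k l : ℕ) :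
    pow A (k + l) = mul (pow A k) (pow A l) := by
  induction l with
  | zero => exact (mul_one' _).symm
  | succ l ih =>
    change mul (pow A (k + l)) A = mul (pow A k) (mul (pow A l) A)
    rw [ih, mul_assoc']

theorem pow_pow' (A : Matrix (Fin n) (Fin n) ℝ≥0) (k l : ℕ) :
    pow (pow A k) l = pow A (k * l) := by
  induction l with
  | zero => rfl
  | succ l ih =>
    change mul (pow (pow A k) l) (pow A k) = _
    rw [ih, ← pow_add', Nat.mul_succ]

theorem pow_mul_pow_le (A : Matrix (Fin n) (Fin n) ℝ≥0) (k l : ℕ) (i x j : Fin n) :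
    pow A k i x * pow A l x j ≤ pow A (k + l) i j := by
  rw [pow_add']
  exact mul_le_mul_apply _ _ i x j

theorem exists_pow_add_eq (A : Matrix (Fin n) (Fin n) ℝ≥0) (k l : ℕ) (i j : Fin n) :
    ∃ x, pow A (k + l) i j = pow A k i x * pow A l x j := by
  rw [pow_add']
  exact exists_mul_apply_eq _ _ i j

theorem pow_mono {A B : Matrix (Fin n) (Fin n) ℝ≥0} (h : ∀ i j, A i j ≤ B i j) (k : ℕ)
    (i j : Fin n) : pow A k i j ≤ pow B k i j := by
  induction k generalizing j with
  | zero => exact le_rfl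
  | succ k ih =>
    obtain ⟨x, hx⟩ := exists_mul_apply_eq (pow A k) A i j
    change mul (pow A k) A i j ≤ mul (pow B k) B i j
    rw [hx]
    exact (mul_le_mul' (ih x) (h x j)).trans (mul_le_mul_apply _ _ i x j)

theorem one_le_pow_mul {A : Matrix (Fin n) (Fin n) ℝ≥0} {k : ℕ} {x : Fin n}
    (h : 1 ≤ pow A k x x) (q : ℕ) : 1 ≤ pow A (k * q) x x := by
  induction q with
  | zero => simp [pow]
  | succ q ih => exact (one_le_mul ih h).trans (pow_mul_pow_le A (k * q) k x x x)

/-! ### Walks -/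

/-- The weight of the walk formed by the first `k` steps of the sequence of nodes `q`. Sequences
indexed by `ℕ` make it easy to cut a walk into pieces. -/
def walkWeight (A : Matrix (Fin n) (Fin n) ℝ≥0) (q : ℕ → Fin n) (k : ℕ) : ℝ≥0 :=
  ∏ u ∈ Finset.range k, A (q u) (q (u + 1))

theorem walkWeight_le_pow (A : Matrix (Fin n) (Fin n) ℝ≥0) (q : ℕ → Fin n) (k : ℕ) :
    walkWeight A q k ≤ pow A k (q 0) (q k) := by
  induction k with
  | zero => simp [walkWeight, pow]
  | succ k ih =>
    rw [walkWeight, Finset.prod_range_succ]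
    exact (mul_le_mul_left ih _).trans (mul_le_mul_apply (pow A k) A _ _ _)

theorem walkWeight_add (A : Matrix (Fin n) (Fin n) ℝ≥0) (q : ℕ → Fin n) (k l : ℕ) :
    walkWeight A q (k + l) = walkWeight A q k * walkWeight A (fun u => q (k + u)) l :=
  Finset.prod_range_add _ _ _

theorem exists_walkWeight_eq_pow {A : Matrix (Fin n) (Fin n) ℝ≥0} {k : ℕ} {i j : Fin n}
    (h : 0 < pow A k i j) :
    ∃ q : ℕ → Fin n, q 0 = i ∧ q k = j ∧ walkWeight A q k = pow A k i j := by
  induction k generalizing j with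
  | zero =>
    have hij : i = j := by
      by_contra hne
      simp [pow, Matrix.one_apply_ne hne] at h
    subst hij
    exact ⟨fun _ => i, rfl, rfl, by simp [walkWeight, pow]⟩
  | succ k ih =>
    obtain ⟨x, hx⟩ := exists_mul_apply_eq (pow A k) A i j
    change 0 < mul (pow A k) A i j at h
    rw [hx] at h
    obtain ⟨q, h0, hk, hw⟩ := ih (pos_of_mul_pos_left h zero_le)
    refine ⟨fun u => if u ≤ k then q u else j, by simpa using h0, by simp, ?_⟩
    change _ = mul (pow A k) A i j
    rw [hx, ← hw, walkWeight, Finset.prod_range_succ, walkWeight]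
    congr 1
    · refine Finset.prod_congr rfl fun u hu => ?_
      have := Finset.mem_range.mp hu
      simp [this.le, Nat.succ_le_of_lt this]
    · simp [hk]

theorem walkWeight_le_mul (A : Matrix (Fin n) (Fin n) ℝ≥0) (q : ℕ → Fin n) {u k : ℕ}
    (h : u ≤ k) :
    walkWeight A q k ≤ pow A u (q 0) (q u) * pow A (k - u) (q u) (q k) := by
  obtain ⟨l, rfl⟩ := Nat.exists_eq_add_of_le h
  rw [walkWeight_add, Nat.add_sub_cancel_left]
  exact mul_le_mul' (walkWeight_le_pow A q u) (walkWeight_le_pow A (fun v => q (u + v)) l)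

theorem walkWeight_le_mul_mul (A : Matrix (Fin n) (Fin n) ℝ≥0) (q : ℕ → Fin n) {u v k : ℕ}
    (huv : u ≤ v) (hvk : v ≤ k) :
    walkWeight A q k ≤
      pow A u (q 0) (q u) * pow A (v - u) (q u) (q v) * pow A (k - v) (q v) (q k) := by
  obtain ⟨l, rfl⟩ := Nat.exists_eq_add_of_le hvk
  rw [walkWeight_add, Nat.add_sub_cancel_left]
  exact mul_le_mul' (walkWeight_le_mul A q huv) (walkWeight_le_pow A (fun w => q (v + w)) l)

theorem edge_pos_of_walkWeight_pos {A : Matrix (Fin n) (Fin n) ℝ≥0} {q : ℕ → Fin n} {k : ℕ}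
    (h : 0 < walkWeight A q k) {u : ℕ} (hu : u < k) : 0 < A (q u) (q (u + 1)) := by
  rw [pos_iff_ne_zero] at h ⊢
  exact Finset.prod_ne_zero_iff.mp h u (Finset.mem_range.mpr hu)

theorem subwalk_pos {A : Matrix (Fin n) (Fin n) ℝ≥0} {q : ℕ → Fin n} {u v k : ℕ}
    (h : 0 < walkWeight A q k) (huv : u ≤ v) (hvk : v ≤ k) :
    0 < pow A (v - u) (q u) (q v) :=
  pos_of_mul_pos_right
    (pos_of_mul_pos_left (h.trans_le (walkWeight_le_mul_mul A q huv hvk)) zero_le) zero_le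

/-- Pigeonhole on the pairs (node, position modulo `s`). -/
theorem exists_repeat (q : ℕ → Fin n) {s : ℕ} (hs : 1 ≤ s) :
    ∃ u v, u < v ∧ v ≤ n * s ∧ q u = q v ∧ u ≡ v [MOD s] := by
  have hmaps : ∀ u ∈ Finset.range (n * s + 1),
      (q u, u % s) ∈ (Finset.univ : Finset (Fin n)) ×ˢ Finset.range s := fun u _ => by
    simpa using Nat.mod_lt u hs
  obtain ⟨u, hu, v, hv, hne, heq⟩ :=
    Finset.exists_ne_map_eq_of_card_lt_of_maps_to (by simp) hmaps
  rw [Finset.mem_range] at hu hv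
  obtain ⟨h1, h2⟩ := Prod.mk.inj heq
  rcases lt_or_gt_of_ne hne with h | h
  · exact ⟨u, v, h, by omega, h1, h2⟩
  · exact ⟨v, u, h, by omega, h1.symm, h2.symm⟩

/-- A walk can be cut down to length less than `n * s` by removing closed subwalks whose lengths are
multiples of `s`. -/
theorem exists_pow_le_of_closed_le_one {A : Matrix (Fin n) (Fin n) ℝ≥0}
    (hA : ∀ k x, pow A k x x ≤ 1) {s : ℕ} (hs : 1 ≤ s) (k : ℕ) (i j : Fin n) :
    ∃ l, l < n * s ∧ l ≡ k [MOD s] ∧ pow A k i j ≤ pow A l i j := by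
  have hn : 0 < n := i.pos
  induction k using Nat.strong_induction_on with
  | _ k ih =>
  by_cases hk : k < n * s
  · exact ⟨k, hk, rfl, le_rfl⟩
  rcases eq_zero_or_pos (pow A k i j) with h0 | hpos
  · refine ⟨k % s, (Nat.mod_lt k hs).trans_le (Nat.le_mul_of_pos_left s hn),
      Nat.mod_modEq k s, ?_⟩
    rw [h0]
    exact zero_le
  obtain ⟨q, rfl, rfl, hw⟩ := exists_walkWeight_eq_pow hpos
  obtain ⟨u, v, huv, hv, hq, hmod⟩ := exists_repeat q hs
  obtain ⟨l, hl, hlk, hle⟩ := ih (u + (k - v)) (by omega)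
  have hk' : u + (k - v) ≡ k [MOD s] := by
    have := hmod.add_right (k - v)
    rwa [show v + (k - v) = k by omega] at this
  refine ⟨l, hl, hlk.trans hk', le_trans ?_ hle⟩
  rw [← hw]
  refine (walkWeight_le_mul_mul A q huv.le (hv.trans (not_lt.mp hk))).trans ?_
  refine le_trans ?_ (pow_mul_pow_le A u (k - v) _ (q u) _)
  rw [← hq]
  exact mul_le_mul_left (mul_le_of_le_one_right zero_le (hA _ _)) _

/-! ### The maximum cycle geometric mean -/

theorem weight_comp_eq_walkWeight (A : Matrix (Fin n) (Fin n) ℝ≥0) (q : ℕ → Fin n) (k : ℕ) :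
    weight A (fun u : Fin (k + 1) => q u) = walkWeight A q k := by
  rw [walkWeight, Finset.prod_range]
  rfl

theorem isCycle_digraph_of_walkWeight_pos {A : Matrix (Fin n) (Fin n) ℝ≥0} {q : ℕ → Fin n}
    {k : ℕ} (hk : 1 ≤ k) (h : 0 < walkWeight A q k) (hq : q 0 = q k) :
    (digraph A).IsCycle (fun u : Fin (k + 1) => q u) := by
  refine ⟨hk, ⟨fun _ => Finset.mem_univ _, fun u => ?_⟩, by simpa using hq⟩
  simpa [digraph] using (edge_pos_of_walkWeight_pos h u.isLt).ne'

theorem pow_self_le_mcgm_pow_of_le (A : Matrix (Fin n) (Fin n) ℝ≥0) {k : ℕ} (hk : 1 ≤ k)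
    (hkn : k ≤ n) (x : Fin n) : pow A k x x ≤ mcgm A ^ k := by
  classical
  rcases eq_zero_or_pos (pow A k x x) with h0 | hpos
  · rw [h0]; exact zero_le
  obtain ⟨q, h0, hqk, hw⟩ := exists_walkWeight_eq_pow hpos
  have hcyc := isCycle_digraph_of_walkWeight_pos hk (hw ▸ hpos) (h0.trans hqk.symm)
  have hle : walkWeight A q k ^ (1 / (k : ℝ)) ≤ mcgm A := by
    rw [← weight_comp_eq_walkWeight]
    refine le_trans ?_ (Finset.le_sup (Finset.mem_Icc.mpr ⟨hk, hkn⟩))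
    exact Finset.le_sup (f := fun p : Fin (k + 1) → Fin n => weight A p ^ (1 / (k : ℝ)))
      (Finset.mem_filter.mpr ⟨Finset.mem_univ _, hcyc⟩)
  rw [← hw]
  have h1 := pow_le_pow_left₀ zero_le hle k
  rwa [one_div, NNReal.rpow_inv_natCast_pow _ (by omega)] at h1

theorem pow_self_le_mcgm_pow (A : Matrix (Fin n) (Fin n) ℝ≥0) (k : ℕ) (x : Fin n) :
    pow A k x x ≤ mcgm A ^ k := by
  induction k using Nat.strong_induction_on generalizing x with
  | _ k ih =>
  rcases Nat.eq_zero_or_pos k with rfl | hk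
  · simp [pow]
  by_cases hkn : k ≤ n
  · exact pow_self_le_mcgm_pow_of_le A hk hkn x
  rcases eq_zero_or_pos (pow A k x x) with h0 | hpos
  · rw [h0]; exact zero_le
  obtain ⟨q, h0, hqk, hw⟩ := exists_walkWeight_eq_pow hpos
  obtain ⟨u, v, huv, hv, hq, -⟩ := exists_repeat q le_rfl
  rw [mul_one] at hv
  have hmain := walkWeight_le_mul_mul A q huv.le (show v ≤ k by omega)
  rw [hw, h0, hqk, ← hq, mul_right_comm] at hmain
  refine hmain.trans ((mul_le_mul' ((pow_mul_pow_le A u (k - v) x (q u) x).trans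
    (ih _ (by omega) x)) (ih _ (by omega) (q u))).trans_eq ?_)
  rw [← pow_add]
  congr 1
  omega

theorem exists_pow_self_pos_of_mcgm_pos {A : Matrix (Fin n) (Fin n) ℝ≥0} (h : 0 < mcgm A) :
    ∃ k x, 1 ≤ k ∧ 0 < pow A k x x := by
  classical
  by_contra! hcon
  refine h.ne' (le_antisymm (Finset.sup_le fun k _ => Finset.sup_le fun p hp => ?_) zero_le)
  have hp := (Finset.mem_filter.mp hp).2
  have hle : weight A p ≤ pow A k (p 0) (p (Fin.last k)) := by
    have := walkWeight_le_pow A (fun u => p (Fin.ofNat (k + 1) u)) k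
    rw [← weight_comp_eq_walkWeight] at this
    simpa [Fin.ofNat_self, Fin.last] using this
  rw [← hp.2.2] at hle
  have h0 : weight A p = 0 := le_antisymm (hle.trans (hcon k _ hp.1)) zero_le
  have hk : (1 / (k : ℝ)) ≠ 0 := by
    have := hp.1
    positivity
  rw [h0, NNReal.zero_rpow hk]

theorem mcgm_pos_of_le {A B : Matrix (Fin n) (Fin n) ℝ≥0} (h : ∀ i j, A i j ≤ B i j)
    (hA : 0 < mcgm A) : 0 < mcgm B := by
  obtain ⟨k, x, hk, hpos⟩ := exists_pow_self_pos_of_mcgm_pos hA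
  by_contra h0
  have hB := pow_self_le_mcgm_pow B k x
  rw [le_antisymm (not_lt.mp h0) zero_le, zero_pow (by omega)] at hB
  exact (hpos.trans_le ((pow_mono h k x x).trans hB)).false

theorem pow_eq_zero_of_mcgm_eq_zero {A : Matrix (Fin n) (Fin n) ℝ≥0} (h : mcgm A = 0) {t : ℕ}
    (ht : n ≤ t) (i j : Fin n) : pow A t i j = 0 := by
  by_contra hne
  obtain ⟨q, -, -, hw⟩ := exists_walkWeight_eq_pow (pos_iff_ne_zero.mpr hne)
  obtain ⟨u, v, huv, hv, hq, -⟩ := exists_repeat q le_rfl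
  have hpos := subwalk_pos (hw ▸ pos_iff_ne_zero.mpr hne : 0 < walkWeight A q t) huv.le
    (show v ≤ t by omega)
  have hle := pow_self_le_mcgm_pow A (v - u) (q u)
  rw [h, zero_pow (by omega)] at hle
  rw [← hq] at hpos
  exact (hpos.trans_le hle).false

/-! ### Normalization -/

theorem pow_eq_mcgm_pow_mul {A : Matrix (Fin n) (Fin n) ℝ≥0} (hA : 0 < mcgm A) (k : ℕ)
    (i j : Fin n) : pow A k i j = mcgm A ^ k * pow (normalized A) k i j := by
  induction k generalizing j with
  | zero => simp [pow]
  | succ k ih =>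
    change (Finset.univ.sup fun x => pow A k i x * A x j) =
      mcgm A ^ (k + 1) * Finset.univ.sup fun x => pow (normalized A) k i x * normalized A x j
    rw [NNReal.mul_finset_sup]
    refine Finset.sup_congr rfl fun x _ => ?_
    rw [ih]
    have := hA.ne'
    change mcgm A ^ k * pow (normalized A) k i x * A x j =
      mcgm A ^ (k + 1) * (pow (normalized A) k i x * (A x j / mcgm A))
    field_simp
    ring

theorem pow_normalized_self_le_one {A : Matrix (Fin n) (Fin n) ℝ≥0} (hA : 0 < mcgm A) (k : ℕ)
    (x : Fin n) : pow (normalized A) k x x ≤ 1 := by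
  have h := pow_self_le_mcgm_pow A k x
  rw [pow_eq_mcgm_pow_mul hA] at h
  exact (mul_le_iff_le_one_right (pow_pos hA k)).mp h

theorem starFinite_pow_normalized {A : Matrix (Fin n) (Fin n) ℝ≥0} (hA : 0 < mcgm A) (g : ℕ) :
    StarFinite (pow (normalized A) g) := by
  intro i j
  refine ⟨(Finset.range n).sup fun l => pow (normalized A) l i j, ?_⟩
  rintro _ ⟨k, rfl⟩
  obtain ⟨l, hl, -, hle⟩ :=
    exists_pow_le_of_closed_le_one (pow_normalized_self_le_one hA) le_rfl (g * k) i j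
  change pow (pow (normalized A) g) k i j ≤ _
  rw [pow_pow']
  refine hle.trans (Finset.le_sup (f := fun l => pow (normalized A) l i j) ?_)
  rwa [Finset.mem_range, ← mul_one n]

theorem pow_normalized_le_matB {A : Matrix (Fin n) (Fin n) ℝ≥0} (hA : 0 < mcgm A) (G : Graph n)
    {l : ℕ} (hl : G.cyclicity ∣ l) (i j : Fin n) :
    pow (normalized A) l i j ≤ matB A G i j := by
  obtain ⟨k, rfl⟩ := hl
  rw [← pow_pow']
  exact le_ciSup (starFinite_pow_normalized hA G.cyclicity i j) k

/-! ### Closed walks in a completely reducible subdigraph of the critical digraph -/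

theorem matS_le_normalized (A : Matrix (Fin n) (Fin n) ℝ≥0) (G : Graph n) (i j : Fin n) :
    matS A G i j ≤ normalized A i j := by
  simp only [matS, Matrix.of_apply]
  split_ifs
  · exact le_rfl
  · exact zero_le

theorem mem_edges_of_matS_pos {A : Matrix (Fin n) (Fin n) ℝ≥0} {G : Graph n} {i j : Fin n}
    (h : 0 < matS A G i j) : (i, j) ∈ G.edges := by
  by_contra hne
  simp [matS, hne] at h

/-- The rest of a critical cycle through an edge of the critical digraph compensates the weight of
that edge. -/
theorem exists_one_le_edge_mul_pow {A : Matrix (Fin n) (Fin n) ℝ≥0} (hA : 0 < mcgm A)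
    {i j : Fin n} (h : (i, j) ∈ (critical A).edges) :
    ∃ k, 1 ≤ normalized A i j * pow (normalized A) k j i := by
  classical
  obtain ⟨k, p, hp, u, hu⟩ := (Finset.mem_filter.mp h).2
  obtain ⟨rfl, rfl⟩ := Prod.mk.inj hu
  set q : ℕ → Fin n := fun u => p (Fin.ofNat (k + 1) u) with hq
  have hpq : p = fun u : Fin (k + 1) => q u := by
    funext u
    simp [hq]
  have hk : k ≠ 0 := by have := hp.1.1; omega
  have hqk : q k = q 0 := by
    have := hp.1.2.2
    rw [hpq] at this
    simpa using this.symm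
  have hwA : walkWeight A q k = mcgm A ^ k := by
    have := hp.2
    rw [hpq, weight_comp_eq_walkWeight] at this
    rw [← this, one_div, NNReal.rpow_inv_natCast_pow _ hk]
  have hw : walkWeight (normalized A) q k = 1 := by
    have : walkWeight (normalized A) q k = walkWeight A q k / mcgm A ^ k := by
      simp [walkWeight, normalized, Finset.prod_div_distrib]
    rw [this, hwA, div_self (pow_pos hA k).ne']
  have hcut := walkWeight_le_mul_mul (normalized A) q (Nat.le_succ u.val) (Nat.succ_le_of_lt u.isLt)
  rw [hw, hqk, Nat.succ_eq_add_one, Nat.add_sub_cancel_left, pow_one', mul_right_comm,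
    mul_comm] at hcut
  have h1 : p u.castSucc = q u := by rw [hpq]; simp
  have h2 : p u.succ = q (u + 1) := by rw [hpq]; simp
  rw [h1, h2]
  refine ⟨k - (u + 1) + u, hcut.trans (mul_le_mul_right ?_ _)⟩
  rw [mul_comm]
  exact pow_mul_pow_le _ _ _ _ _ _

theorem exists_one_le_pow_matS_mul_pow {A : Matrix (Fin n) (Fin n) ℝ≥0} (hA : 0 < mcgm A)
    {G : Graph n} (hG : G.IsSub (critical A)) {k : ℕ} {i j : Fin n} (h : 0 < pow (matS A G) k i j) :
    ∃ l, 1 ≤ pow (matS A G) k i j * pow (normalized A) l j i := by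
  induction k generalizing j with
  | zero =>
    have hij : i = j := by
      by_contra hne
      simp [pow, Matrix.one_apply_ne hne] at h
    subst hij
    exact ⟨0, by simp [pow]⟩
  | succ k ih =>
    obtain ⟨x, hx⟩ := exists_mul_apply_eq (pow (matS A G) k) (matS A G) i j
    change 0 < mul (pow (matS A G) k) (matS A G) i j at h
    change ∃ l, 1 ≤ mul (pow (matS A G) k) (matS A G) i j * _
    rw [hx] at h ⊢
    have hedge := mem_edges_of_matS_pos (pos_of_mul_pos_right h zero_le)
    obtain ⟨l, hl⟩ := ih (pos_of_mul_pos_left h zero_le)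
    obtain ⟨l', hl'⟩ := exists_one_le_edge_mul_pow hA (hG.2 hedge)
    have hS : matS A G x j = normalized A x j := by simp [matS, hedge]
    refine ⟨l' + l, (one_le_mul hl hl').trans ?_⟩
    rw [hS, mul_mul_mul_comm, mul_comm (pow (normalized A) l x i)]
    exact mul_le_mul_right (pow_mul_pow_le _ _ _ _ _ _) _

/-- Closed walks in a subdigraph of the critical digraph have normalized weight at least `1`: they
are compensated by a closed walk, whose weight is at most `1`. -/
theorem one_le_pow_matS_self {A : Matrix (Fin n) (Fin n) ℝ≥0} (hA : 0 < mcgm A)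
    {G : Graph n} (hG : G.IsSub (critical A)) {k : ℕ} {x : Fin n} (h : 0 < pow (matS A G) k x x) :
    1 ≤ pow (matS A G) k x x := by
  obtain ⟨l, hl⟩ := exists_one_le_pow_matS_mul_pow hA hG h
  exact hl.trans (mul_le_of_le_one_right zero_le (pow_normalized_self_le_one hA l x))

theorem one_le_pow_normalized_self {A : Matrix (Fin n) (Fin n) ℝ≥0} (hA : 0 < mcgm A)
    {G : Graph n} (hG : G.IsSub (critical A)) {k : ℕ} {x : Fin n} (h : 0 < pow (matS A G) k x x) :
    1 ≤ pow (normalized A) k x x :=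
  (one_le_pow_matS_self hA hG h).trans (pow_mono (matS_le_normalized A G) k x x)

theorem matS_pos {A : Matrix (Fin n) (Fin n) ℝ≥0} (hA : 0 < mcgm A) {G : Graph n}
    (hG : G.IsSub (critical A)) {i j : Fin n} (h : (i, j) ∈ G.edges) : 0 < matS A G i j := by
  obtain ⟨k, hk⟩ := exists_one_le_edge_mul_pow hA (hG.2 h)
  have : matS A G i j = normalized A i j := by simp [matS, h]
  rw [this]
  exact pos_of_mul_pos_left (zero_lt_one.trans_le hk) zero_le

theorem pow_matS_pos_of_isPath {A : Matrix (Fin n) (Fin n) ℝ≥0} (hA : 0 < mcgm A) {G : Graph n}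
    (hG : G.IsSub (critical A)) {k : ℕ} {p : Fin (k + 1) → Fin n} (hp : G.IsPath p) :
    0 < pow (matS A G) k (p 0) (p (Fin.last k)) := by
  have hle : weight (matS A G) p ≤ pow (matS A G) k (p 0) (p (Fin.last k)) := by
    have := walkWeight_le_pow (matS A G) (fun u => p (Fin.ofNat (k + 1) u)) k
    rw [← weight_comp_eq_walkWeight] at this
    simpa [Fin.ofNat_self, Fin.last] using this
  refine lt_of_lt_of_le ?_ hle
  exact Finset.prod_pos fun u _ => matS_pos hA hG (hp.2 u)

theorem pow_matS_pos_add {A : Matrix (Fin n) (Fin n) ℝ≥0} {G : Graph n} {k l : ℕ} {i x j : Fin n}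
    (h1 : 0 < pow (matS A G) k i x) (h2 : 0 < pow (matS A G) l x j) :
    0 < pow (matS A G) (k + l) i j :=
  (mul_pos h1 h2).trans_le (pow_mul_pow_le _ _ _ _ _ _)

theorem pow_matS_pos_mul {A : Matrix (Fin n) (Fin n) ℝ≥0} {G : Graph n} {k : ℕ} {x : Fin n}
    (h : 0 < pow (matS A G) k x x) (c : ℕ) : 0 < pow (matS A G) (k * c) x x := by
  induction c with
  | zero => simp [pow]
  | succ c ih => exact pow_matS_pos_add ih h

theorem isPath_of_walkWeight_matS_pos {A : Matrix (Fin n) (Fin n) ℝ≥0} {G : Graph n}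
    {q : ℕ → Fin n} {k : ℕ} (h : 0 < walkWeight (matS A G) q k) (h0 : q 0 ∈ G.nodes) :
    G.IsPath (fun u : Fin (k + 1) => q u) := by
  have hedge : ∀ u, u < k → (q u, q (u + 1)) ∈ G.edges := fun u hu =>
    mem_edges_of_matS_pos (edge_pos_of_walkWeight_pos h hu)
  refine ⟨fun u => ?_, fun u => hedge u u.isLt⟩
  obtain ⟨u, hu⟩ := u
  cases u with
  | zero => exact h0
  | succ u => exact G.tgt_mem _ (hedge u (by omega))

theorem mem_nodes_of_pow_matS_pos {A : Matrix (Fin n) (Fin n) ℝ≥0} {G : Graph n}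
    {k : ℕ} {i j : Fin n} (h : 0 < pow (matS A G) k i j) (hi : i ∈ G.nodes) : j ∈ G.nodes := by
  obtain ⟨q, rfl, rfl, hw⟩ := exists_walkWeight_eq_pow h
  exact (isPath_of_walkWeight_matS_pos (hw ▸ h) hi).1 (Fin.last k)

theorem reaches_of_pow_matS_pos {A : Matrix (Fin n) (Fin n) ℝ≥0} {G : Graph n}
    {k : ℕ} {i j : Fin n} (h : 0 < pow (matS A G) k i j) (hi : i ∈ G.nodes) : G.Reaches i j := by
  obtain ⟨q, rfl, rfl, hw⟩ := exists_walkWeight_eq_pow h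
  exact ⟨k, _, isPath_of_walkWeight_matS_pos (hw ▸ h) hi, rfl, rfl⟩

/-- A shortest closed walk at a node is a simple cycle; its length contributes to the cyclicity of
the component. -/
theorem exists_simple_cycle_length {A : Matrix (Fin n) (Fin n) ℝ≥0} (hA : 0 < mcgm A) {G : Graph n}
    (hG : G.IsSub (critical A)) (hR : G.IsCompletelyReducible) {x : Fin n} (hx : x ∈ G.nodes) :
    ∃ s, 1 ≤ s ∧ s ≤ n ∧ 0 < pow (matS A G) s x x ∧ G.componentCyclicity x ∣ s := by
  classical
  have hex : ∃ s, 1 ≤ s ∧ 0 < pow (matS A G) s x x := by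
    obtain ⟨k, p, hp, rfl⟩ := hR.2.2 x hx
    have := pow_matS_pos_of_isPath hA hG hp.2.1
    rw [← hp.2.2] at this
    exact ⟨k, hp.1, this⟩
  obtain ⟨hs1, hs⟩ := Nat.find_spec hex
  have hmin : ∀ l, 1 ≤ l → 0 < pow (matS A G) l x x → Nat.find hex ≤ l := fun l h1 h2 =>
    Nat.find_min' hex ⟨h1, h2⟩
  generalize Nat.find hex = s at hs1 hs hmin
  obtain ⟨q, h0, hqs, hw⟩ := exists_walkWeight_eq_pow hs
  have hwpos : 0 < walkWeight (matS A G) q s := hw ▸ hs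
  have hfrom : ∀ u ≤ s, 0 < pow (matS A G) u x (q u) := fun u hu => by
    have := subwalk_pos hwpos (Nat.zero_le u) hu
    rwa [Nat.sub_zero, h0] at this
  have hto : ∀ u ≤ s, 0 < pow (matS A G) (s - u) (q u) x := fun u hu => by
    have := subwalk_pos hwpos hu le_rfl
    rwa [hqs] at this
  have hlt : ∀ u v, u < v → v < s → q u ≠ q v := fun u v huv hv heq => by
    have h1 := hfrom u (by omega)
    rw [heq] at h1
    have := hmin _ (by omega) (pow_matS_pos_add h1 (hto v hv.le))
    omega
  have hinj : Function.Injective fun u : Fin s => q u := fun u v heq => by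
    by_contra hne
    rcases lt_or_gt_of_ne (fun h => hne (Fin.ext h) : u.val ≠ v.val) with h | h
    · exact hlt u v h v.isLt heq
    · exact hlt v u h u.isLt heq.symm
  have hsn : s ≤ n := by simpa using Fintype.card_le_of_injective _ hinj
  refine ⟨s, hs1, hsn, hs, Finset.gcd_dvd (f := id) (Finset.mem_filter.mpr
    ⟨Finset.mem_Icc.mpr ⟨hs1, hsn⟩, fun u => q u, ⟨⟨hs1, ?_, ?_⟩, hinj⟩, fun u => ?_⟩)⟩
  · exact isPath_of_walkWeight_matS_pos hwpos (h0 ▸ hx)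
  · simpa using h0.trans hqs.symm
  · have hu : u.val ≤ s := Nat.lt_succ_iff.mp u.isLt
    exact ⟨reaches_of_pow_matS_pos (hfrom u hu) hx, reaches_of_pow_matS_pos (hto u hu)
      (mem_nodes_of_pow_matS_pos (hfrom u hu) hx)⟩

theorem cyclicity_pos {A : Matrix (Fin n) (Fin n) ℝ≥0} (hA : 0 < mcgm A) {G : Graph n}
    (hG : G.IsSub (critical A)) (hR : G.IsCompletelyReducible) : 0 < G.cyclicity := by
  refine Nat.pos_of_ne_zero fun h => ?_
  obtain ⟨x, hx, h0⟩ := Finset.lcm_eq_zero_iff.mp h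
  obtain ⟨s, hs1, -, -, hdvd⟩ := exists_simple_cycle_length hA hG hR hx
  rw [h0, zero_dvd_iff] at hdvd
  omega

/-- Modulo `M`, the lengths of the closed walks at `x` include all multiples of the cyclicity of the
component of `x`: they are closed under addition, hence form a subgroup of the finite cyclic group
`ℤ / M`, and this subgroup contains the lengths of all simple cycles of the component, because such a
cycle can be inserted into a closed walk at `x`. -/
theorem exists_closed_walk_length {A : Matrix (Fin n) (Fin n) ℝ≥0} (hA : 0 < mcgm A) {G : Graph n}
    (hG : G.IsSub (critical A)) (x : Fin n) {M : ℕ} (hM : 1 ≤ M)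
    {d : ℤ} (hd : (G.componentCyclicity x : ℤ) ∣ d) :
    ∃ k : ℕ, 0 < pow (matS A G) k x x ∧ (k : ℤ) ≡ d [ZMOD M] := by
  classical
  let H : AddSubgroup ℤ :=
    { carrier := {d | ∃ k : ℕ, 0 < pow (matS A G) k x x ∧ (k : ℤ) ≡ d [ZMOD M]}
      zero_mem' := ⟨0, by simp [pow], rfl⟩
      add_mem' := by
        rintro a b ⟨k, hk, hka⟩ ⟨l, hl, hlb⟩
        exact ⟨k + l, pow_matS_pos_add hk hl, by push_cast; exact hka.add hlb⟩
      neg_mem' := by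
        rintro a ⟨k, hk, hka⟩
        refine ⟨k * (M - 1), pow_matS_pos_mul hk _, ?_⟩
        have h1 : ((k * (M - 1) : ℕ) : ℤ) = -k + M * k := by
          push_cast [Nat.cast_sub hM]
          ring
        rw [h1]
        exact (Int.ModEq.symm (Int.modEq_iff_dvd.mpr ⟨k, by ring⟩)).trans hka.neg }
  change d ∈ H
  obtain ⟨e, he⟩ := Int.subgroup_cyclic H
  rw [← AddSubgroup.zmultiples_eq_closure] at he
  have hmem : ∀ z : ℤ, z ∈ H ↔ e ∣ z := fun z => by
    rw [he, Int.mem_zmultiples_iff]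
  rw [hmem]
  refine dvd_trans ?_ hd
  rw [← Int.natAbs_dvd, Int.natCast_dvd_natCast]
  refine Finset.dvd_gcd fun k hk => ?_
  obtain ⟨p, hp, hcomp⟩ := (Finset.mem_filter.mp hk).2
  rw [id, ← Int.natCast_dvd_natCast, Int.natAbs_dvd, ← hmem]
  obtain ⟨⟨a, pa, hpa, rfl, hpa'⟩, ⟨b, pb, hpb, hpb', hpb''⟩⟩ := hcomp 0
  have h1 := pow_matS_pos_of_isPath hA hG hpa
  have h2 := pow_matS_pos_of_isPath hA hG hpb
  have h3 := pow_matS_pos_of_isPath hA hG hp.1.2.1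
  rw [← hp.1.2.2] at h3
  rw [hpa'] at h1
  rw [hpb', hpb''] at h2
  have hmem1 : ((a + b : ℕ) : ℤ) ∈ H := ⟨a + b, pow_matS_pos_add h1 h2, rfl⟩
  have hmem2 : ((a + k + b : ℕ) : ℤ) ∈ H :=
    ⟨a + k + b, pow_matS_pos_add (pow_matS_pos_add h1 h3) h2, rfl⟩
  have := H.sub_mem hmem2 hmem1
  rwa [show ((a + k + b : ℕ) : ℤ) - ((a + b : ℕ) : ℤ) = k by push_cast; ring] at this

/-! ### Comparing powers with CSR products -/

/-- A walk through a node `x` of `G` whose length is congruent to `t` modulo the cyclicity can be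
replaced by a walk of length exactly `t`. If `s` is the length of a critical cycle through `x`, insert
a critical closed walk at `x` to make the length congruent to `t` modulo `s`, shorten both halves
modulo `s`, and fill up with copies of the cycle. -/
theorem pow_mul_pow_le_of_modEq {A : Matrix (Fin n) (Fin n) ℝ≥0} (hA : 0 < mcgm A) {G : Graph n}
    (hG : G.IsSub (critical A)) (hR : G.IsCompletelyReducible) {x : Fin n} (hx : x ∈ G.nodes)
    {k l t : ℕ} (hmod : k + l ≡ t [MOD G.cyclicity]) (ht : 2 * n ^ 2 ≤ t) (i j : Fin n) :
    pow (normalized A) k i x * pow (normalized A) l x j ≤ pow (normalized A) t i j := by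
  obtain ⟨s, hs1, hsn, hs, -⟩ := exists_simple_cycle_length hA hG hR hx
  have hdvd : (G.componentCyclicity x : ℤ) ∣ (t : ℤ) - (k + l : ℕ) :=
    (Int.natCast_dvd_natCast.mpr (Finset.dvd_lcm hx)).trans hmod.dvd
  obtain ⟨c, hc, hcmod⟩ := exists_closed_walk_length hA hG x hs1 hdvd
  have hA1 := pow_normalized_self_le_one hA
  obtain ⟨k', hk', hkk, hkle⟩ := exists_pow_le_of_closed_le_one hA1 hs1 (k + c) i x
  obtain ⟨l', hl', hll, hlle⟩ := exists_pow_le_of_closed_le_one hA1 hs1 l x j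
  have hlen : k' + l' ≡ t [MOD s] := by
    refine (hkk.add hll).trans ?_
    rw [← Int.natCast_modEq_iff]
    have := hcmod.add_left ((k + l : ℕ) : ℤ)
    push_cast at this ⊢
    rwa [show (k : ℤ) + l + (t - (k + l)) = t by ring,
      show (k : ℤ) + l + c = k + c + l by ring] at this
  have hns : n * s ≤ n ^ 2 := by
    rw [sq]
    exact Nat.mul_le_mul_left n hsn
  have hle : k' + l' ≤ t := by omega
  obtain ⟨m, hm⟩ := (Nat.modEq_iff_dvd' hle).mp hlen
  have hfill := one_le_pow_mul (one_le_pow_normalized_self hA hG hs) m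
  have hins : pow (normalized A) k i x ≤ pow (normalized A) k' i x :=
    (le_mul_of_one_le_right zero_le (one_le_pow_normalized_self hA hG hc)).trans
      ((pow_mul_pow_le _ _ _ _ _ _).trans hkle)
  calc pow (normalized A) k i x * pow (normalized A) l x j
      ≤ pow (normalized A) k' i x * pow (normalized A) (s * m) x x * pow (normalized A) l' x j :=
        mul_le_mul' (hins.trans (le_mul_of_one_le_right zero_le hfill)) hlle
    _ ≤ pow (normalized A) (k' + s * m) i x * pow (normalized A) l' x j :=
        mul_le_mul_left (pow_mul_pow_le _ _ _ _ _ _) _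
    _ ≤ pow (normalized A) (k' + s * m + l') i j := pow_mul_pow_le _ _ _ _ _ _
    _ = pow (normalized A) t i j := by
        congr 1
        omega

theorem csr_le_pow_normalized {A : Matrix (Fin n) (Fin n) ℝ≥0} (hA : 0 < mcgm A) {G : Graph n}
    (hG : G.IsSub (critical A)) (hR : G.IsCompletelyReducible) {t : ℕ} (ht : 2 * n ^ 2 ≤ t)
    (i j : Fin n) : csr A G t i j ≤ pow (normalized A) t i j := by
  obtain ⟨y, hy⟩ := exists_mul_apply_eq (mul (matC A G) (pow (matS A G) t)) (matR A G) i j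
  obtain ⟨x, hx⟩ := exists_mul_apply_eq (matC A G) (pow (matS A G) t) i y
  rw [csr, hy, hx]
  by_cases hxG : x ∈ G.nodes
  swap
  · simp [matC, hxG]
  by_cases hyG : y ∈ G.nodes
  swap
  · simp [matR, hyG]
  simp only [matC, matR, matB, star, Matrix.of_apply, hxG, hyG, if_true]
  rw [NNReal.iSup_mul, NNReal.iSup_mul]
  refine ciSup_le fun k => ?_
  rw [NNReal.mul_iSup]
  refine ciSup_le fun l => ?_
  rw [pow_pow', pow_pow', mul_assoc]
  refine le_trans (mul_le_mul_right ?_ _) (pow_mul_pow_le_of_modEq hA hG hR hxG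
    (k := G.cyclicity * k) (l := t + G.cyclicity * l) ?_ ht i j)
  · exact (mul_le_mul_left (pow_mono (matS_le_normalized A G) t x y) _).trans
      (pow_mul_pow_le _ _ _ _ _ _)
  · rw [Nat.modEq_iff_dvd]
    exact ⟨-(k + l), by push_cast; ring⟩

/-- A walk of length `k + l` through a node `x` of `G` is dominated by the CSR product: at `x` insert
a long critical closed walk, and cut it so that its two ends complete the lengths `k` and `l` to
multiples of the cyclicity, while its middle part has length `k + l`. -/
theorem pow_mul_pow_le_csr {A : Matrix (Fin n) (Fin n) ℝ≥0} (hA : 0 < mcgm A) {G : Graph n}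
    (hG : G.IsSub (critical A)) (hR : G.IsCompletelyReducible) {x : Fin n} (hx : x ∈ G.nodes)
    (k l : ℕ) (i j : Fin n) :
    pow (normalized A) k i x * pow (normalized A) l x j ≤ csr A G (k + l) i j := by
  obtain ⟨s, hs1, -, hs, -⟩ := exists_simple_cycle_length hA hG hR hx
  have hγ := cyclicity_pos hA hG hR
  set γ := G.cyclicity
  obtain ⟨r, hr⟩ : ∃ r, γ ∣ k + r := ⟨k * (γ - 1), k, by
    rw [← mul_one_add, mul_comm]
    congr 1
    omega⟩
  obtain ⟨L, hLγ, hLs, hLle⟩ : ∃ L, γ ∣ L ∧ s ∣ L ∧ r + (k + l) ≤ L :=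
    ⟨s * γ * (r + (k + l)), (Dvd.intro_left s rfl).mul_right _, (Dvd.intro γ rfl).mul_right _,
      Nat.le_mul_of_pos_left _ (Nat.mul_pos hs1 hγ)⟩
  obtain ⟨v, hv⟩ := Nat.exists_eq_add_of_le hLle
  have hvl : γ ∣ v + l := by
    have h : k + r + (v + l) = L := by omega
    exact (Nat.dvd_add_right hr).mp (h ▸ hLγ)
  obtain ⟨m, hm⟩ := hLs
  have hclosed : 0 < pow (matS A G) (r + (k + l) + v) x x := by
    rw [← hv, hm]
    exact pow_matS_pos_mul hs m
  have hone := one_le_pow_matS_self hA hG hclosed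
  obtain ⟨c, hc⟩ := exists_pow_add_eq (matS A G) (r + (k + l)) v x x
  obtain ⟨b, hb⟩ := exists_pow_add_eq (matS A G) r (k + l) x c
  rw [hc, hb] at hclosed hone
  have hxb := pos_of_mul_pos_left (pos_of_mul_pos_left hclosed zero_le) zero_le
  have hbc := pos_of_mul_pos_right (pos_of_mul_pos_left hclosed zero_le) zero_le
  have hbG := mem_nodes_of_pow_matS_pos hxb hx
  have hcG := mem_nodes_of_pow_matS_pos hbc hbG
  have hC : pow (normalized A) k i x * pow (matS A G) r x b ≤ matC A G i b := by
    simp only [matC, Matrix.of_apply, hbG, if_true]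
    exact ((mul_le_mul_right (pow_mono (matS_le_normalized A G) r x b) _).trans
      (pow_mul_pow_le _ _ _ _ _ _)).trans (pow_normalized_le_matB hA G hr i b)
  have hRj : pow (matS A G) v c x * pow (normalized A) l x j ≤ matR A G c j := by
    simp only [matR, Matrix.of_apply, hcG, if_true]
    exact ((mul_le_mul_left (pow_mono (matS_le_normalized A G) v c x) _).trans
      (pow_mul_pow_le _ _ _ _ _ _)).trans (pow_normalized_le_matB hA G hvl c j)
  calc pow (normalized A) k i x * pow (normalized A) l x j
      ≤ pow (normalized A) k i x * pow (normalized A) l x j * (pow (matS A G) r x b *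
          pow (matS A G) (k + l) b c * pow (matS A G) v c x) :=
        le_mul_of_one_le_right zero_le hone
    _ = (pow (normalized A) k i x * pow (matS A G) r x b) * pow (matS A G) (k + l) b c *
          (pow (matS A G) v c x * pow (normalized A) l x j) := by ring
    _ ≤ matC A G i b * pow (matS A G) (k + l) b c * matR A G c j :=
        mul_le_mul' (mul_le_mul_left hC _) hRj
    _ ≤ mul (matC A G) (pow (matS A G) (k + l)) i c * matR A G c j :=
        mul_le_mul_left (mul_le_mul_apply _ _ _ _ _) _
    _ ≤ csr A G (k + l) i j := mul_le_mul_apply _ _ _ _ _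

/-! ### The iterative removal -/

theorem remaining_one (G : ℕ → Graph n) : remaining G 1 = Finset.univ := by
  simp [remaining]

theorem reduced_one (A : Matrix (Fin n) (Fin n) ℝ≥0) (G : ℕ → Graph n) : reduced A G 1 = A := by
  ext1 i j
  simp [reduced, remaining_one]

theorem remaining_succ (G : ℕ → Graph n) {μ : ℕ} (hμ : 1 ≤ μ) :
    remaining G (μ + 1) = remaining G μ \ (G μ).nodes := by
  ext v
  simp only [remaining, Finset.mem_sdiff, Finset.mem_univ, true_and, Finset.mem_biUnion,
    Finset.mem_Ico, not_exists, not_and]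
  constructor
  · exact fun h => ⟨fun u hu => h u ⟨hu.1, by omega⟩, h μ ⟨hμ, by omega⟩⟩
  · rintro ⟨h1, h2⟩ u ⟨hu1, hu2⟩
    rcases (Nat.lt_succ_iff.mp hu2).eq_or_lt with rfl | h
    · exact h2
    · exact h1 u ⟨hu1, h⟩

theorem remaining_anti (G : ℕ → Graph n) {μ ν : ℕ} (h : μ ≤ ν) :
    remaining G ν ⊆ remaining G μ :=
  Finset.sdiff_subset_sdiff le_rfl
    (Finset.biUnion_subset_biUnion_of_subset_left _ (Finset.Ico_subset_Ico_right h))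

theorem reduced_anti (A : Matrix (Fin n) (Fin n) ℝ≥0) (G : ℕ → Graph n) {μ ν : ℕ} (h : μ ≤ ν)
    (i j : Fin n) : reduced A G ν i j ≤ reduced A G μ i j := by
  simp only [reduced, Matrix.of_apply]
  split_ifs with h1 h2
  · exact le_rfl
  · exact absurd ⟨remaining_anti G h h1.1, remaining_anti G h h1.2⟩ h2
  · exact zero_le
  · exact le_rfl

theorem mem_remaining_of_reduced_ne_zero {A : Matrix (Fin n) (Fin n) ℝ≥0} {G : ℕ → Graph n} {μ : ℕ}
    {i j : Fin n} (h : reduced A G μ i j ≠ 0) : i ∈ remaining G μ ∧ j ∈ remaining G μ := by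
  by_contra hne
  simp [reduced, hne] at h

theorem critical_nodes_subset_remaining (A : Matrix (Fin n) (Fin n) ℝ≥0) (G : ℕ → Graph n) (μ : ℕ) :
    (critical (reduced A G μ)).nodes ⊆ remaining G μ := by
  classical
  intro x hx
  obtain ⟨k, p, hp, u, rfl⟩ := (Finset.mem_filter.mp hx).2
  have hedge : ∀ u : Fin k, reduced A G μ (p u.castSucc) (p u.succ) ≠ 0 := fun u => by
    simpa [digraph] using hp.1.2.1.2 u
  have hk := hp.1.1
  obtain ⟨u, hu⟩ := u
  cases u with
  | zero => exact (mem_remaining_of_reduced_ne_zero (hedge ⟨0, hk⟩)).1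
  | succ u => exact (mem_remaining_of_reduced_ne_zero (hedge ⟨u, by omega⟩)).2

theorem card_remaining_succ_lt {A : Matrix (Fin n) (Fin n) ℝ≥0} {G : ℕ → Graph n}
    (hG : IsSelection A G) {μ : ℕ} (hμ : 1 ≤ μ) (hpos : 0 < mcgm (reduced A G μ)) :
    (remaining G (μ + 1)).card < (remaining G μ).card := by
  obtain ⟨hR, hsub⟩ := hG μ hμ hpos
  obtain ⟨x, hx⟩ := hR.1
  rw [remaining_succ G hμ]
  exact Finset.card_lt_card (Finset.sdiff_ssubset
    (hsub.1.trans (critical_nodes_subset_remaining A G μ)) ⟨x, hx⟩)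

theorem exists_last_pos {A : Matrix (Fin n) (Fin n) ℝ≥0} {G : ℕ → Graph n}
    (hG : IsSelection A G) :
    ∃ m ≤ n, ∀ ν, 1 ≤ ν → (0 < mcgm (reduced A G ν) ↔ ν ≤ m) := by
  classical
  have hcard : ∀ m, (∀ ν, 1 ≤ ν → ν ≤ m → 0 < mcgm (reduced A G ν)) →
      (remaining G (m + 1)).card + m ≤ n := by
    intro m
    induction m with
    | zero => simp [remaining_one]
    | succ m ih =>
      intro h
      have h1 := ih fun ν h1 h2 => h ν h1 (by omega)
      have h2 := card_remaining_succ_lt hG (Nat.le_add_left 1 m) (h (m + 1) (by omega) le_rfl)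
      omega
  have hex : ∃ m, ¬ 0 < mcgm (reduced A G (m + 1)) := by
    by_contra! hall
    have := hcard (n + 1) fun ν h1 _ => by
      have := hall (ν - 1)
      rwa [Nat.sub_add_cancel h1] at this
    omega
  have hbelow : ∀ ν, 1 ≤ ν → ν ≤ Nat.find hex → 0 < mcgm (reduced A G ν) := fun ν h1 h2 => by
    have := not_not.mp (Nat.find_min hex (show ν - 1 < Nat.find hex by omega))
    rwa [Nat.sub_add_cancel h1] at this
  refine ⟨Nat.find hex, by have := hcard _ hbelow; omega, fun ν h1 => ⟨fun hpos => ?_, hbelow ν h1⟩⟩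
  by_contra hlt
  exact Nat.find_spec hex
    (mcgm_pos_of_le (reduced_anti A G (show Nat.find hex + 1 ≤ ν by omega)) hpos)

theorem term_le_pow_reduced {A : Matrix (Fin n) (Fin n) ℝ≥0} {G : ℕ → Graph n}
    (hG : IsSelection A G) {ν : ℕ} (hν : 1 ≤ ν) (hpos : 0 < mcgm (reduced A G ν)) {t : ℕ}
    (ht : 2 * n ^ 2 ≤ t) (i j : Fin n) : term A G ν t i j ≤ pow (reduced A G ν) t i j := by
  obtain ⟨hR, hsub⟩ := hG ν hν hpos
  rw [pow_eq_mcgm_pow_mul hpos]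
  exact mul_le_mul_right (csr_le_pow_normalized hpos hsub hR ht i j) _

/-- A walk in the digraph of `A_μ` either meets `N_μ`, and is covered by the term of index `μ`, or is
a walk in the digraph of `A_{μ+1}`. -/
theorem pow_reduced_le {A : Matrix (Fin n) (Fin n) ℝ≥0} {G : ℕ → Graph n}
    (hG : IsSelection A G) {μ : ℕ} (hμ : 1 ≤ μ) (hpos : 0 < mcgm (reduced A G μ)) (t : ℕ)
    (i j : Fin n) :
    pow (reduced A G μ) t i j ≤ term A G μ t i j ⊔ pow (reduced A G (μ + 1)) t i j := by
  obtain ⟨hR, hsub⟩ := hG μ hμ hpos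
  rcases eq_zero_or_pos (pow (reduced A G μ) t i j) with h0 | hw0
  · rw [h0]; exact zero_le
  obtain ⟨q, rfl, rfl, hw⟩ := exists_walkWeight_eq_pow hw0
  have hwpos := hw ▸ hw0
  by_cases hmeet : ∃ u ≤ t, q u ∈ (G μ).nodes
  · obtain ⟨u, hu, hx⟩ := hmeet
    refine le_sup_of_le_left ?_
    rw [← hw]
    refine (walkWeight_le_mul _ q hu).trans ?_
    have h := pow_mul_pow_le_csr hpos hsub hR hx u (t - u) (q 0) (q t)
    rw [pow_eq_mcgm_pow_mul hpos, pow_eq_mcgm_pow_mul hpos, mul_mul_mul_comm, ← pow_add]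
    rw [Nat.add_sub_cancel' hu] at h ⊢
    exact mul_le_mul_right h _
  · push Not at hmeet
    refine le_sup_of_le_right ?_
    refine le_trans (le_of_eq ?_) (walkWeight_le_pow (reduced A G (μ + 1)) q t)
    rw [← hw]
    refine Finset.prod_congr rfl fun u hu => ?_
    have hut := Finset.mem_range.mp hu
    have hrem := mem_remaining_of_reduced_ne_zero (edge_pos_of_walkWeight_pos hwpos hut).ne'
    have h1 := hmeet u hut.le
    have h2 := hmeet (u + 1) hut
    simp [reduced, remaining_succ G hμ, hrem, h1, h2]

theorem le_sum_apply {s : Finset ℕ} (F : ℕ → Matrix (Fin n) (Fin n) ℝ≥0) {ν : ℕ} (hν : ν ∈ s)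
    (i j : Fin n) : F ν i j ≤ sum s F i j :=
  Finset.le_sup (f := fun ν => F ν i j) hν

theorem pow_reduced_le_sum {A : Matrix (Fin n) (Fin n) ℝ≥0} {G : ℕ → Graph n}
    (hG : IsSelection A G) {m : ℕ} (hm : ∀ ν, 1 ≤ ν → (0 < mcgm (reduced A G ν) ↔ ν ≤ m))
    {t : ℕ} (ht : n ≤ t) {μ : ℕ} (hμ : 1 ≤ μ) (hμm : μ ≤ m + 1) (i j : Fin n) :
    pow (reduced A G μ) t i j ≤ sum (Finset.Icc μ m) (fun ν => term A G ν t) i j := by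
  induction hμm using Nat.decreasingInduction with
  | self =>
    have h0 : mcgm (reduced A G (m + 1)) = 0 := by
      by_contra hne
      have := (hm (m + 1) (by omega)).mp (pos_iff_ne_zero.mpr hne)
      omega
    rw [pow_eq_zero_of_mcgm_eq_zero h0 ht]
    exact zero_le
  | of_succ μ hlt ih =>
    refine (pow_reduced_le hG hμ ((hm μ hμ).mpr (by omega)) t i j).trans (sup_le ?_ ?_)
    · exact le_sum_apply (fun ν => term A G ν t) (Finset.mem_Icc.mpr ⟨le_rfl, by omega⟩) i j
    · exact (ih (by omega)).trans (Finset.sup_mono (Finset.Icc_subset_Icc_left (Nat.le_succ μ)))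

theorem pow_reduced_eq_sum {A : Matrix (Fin n) (Fin n) ℝ≥0} {G : ℕ → Graph n}
    (hG : IsSelection A G) {m : ℕ} (hm : ∀ ν, 1 ≤ ν → (0 < mcgm (reduced A G ν) ↔ ν ≤ m))
    {t : ℕ} (ht : 2 * n ^ 2 ≤ t) {μ : ℕ} (hμ : 1 ≤ μ) (hμm : μ ≤ m + 1) :
    pow (reduced A G μ) t = sum (Finset.Icc μ m) fun ν => term A G ν t := by
  ext1 i j
  have hn : n ≤ t := (Nat.le_self_pow two_ne_zero n).trans (by omega)
  refine le_antisymm (pow_reduced_le_sum hG hm hn hμ hμm i j) ?_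
  change (Finset.Icc μ m).sup (fun ν => term A G ν t i j) ≤ _
  refine Finset.sup_le fun ν hν => ?_
  obtain ⟨h1, h2⟩ := Finset.mem_Icc.mp hν
  exact (term_le_pow_reduced hG (by omega) ((hm ν (by omega)).mpr h2) ht i j).trans
    (pow_mono (reduced_anti A G h1) t i j)

end MaxAlg

theorem theorem4p2 (n : ℕ) (A : Matrix (Fin n) (Fin n) ℝ≥0) (G : ℕ → MaxAlg.Graph n)
    (hG : MaxAlg.IsSelection A G) :
    ∃ m : ℕ, m ≤ n ∧
      (∀ ν, 1 ≤ ν → (0 < MaxAlg.mcgm (MaxAlg.reduced A G ν) ↔ ν ≤ m)) ∧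
      (∀ ν, 1 ≤ ν → ν ≤ m → MaxAlg.StarFinite
        (MaxAlg.pow (MaxAlg.normalized (MaxAlg.reduced A G ν)) (G ν).cyclicity)) ∧
      (∀ t, 3 * n ^ 2 ≤ t → ∀ μ, 1 ≤ μ → μ ≤ m →
        MaxAlg.pow (MaxAlg.reduced A G μ) t =
          MaxAlg.sum (Finset.Icc μ m) fun ν => MaxAlg.term A G ν t) ∧
      (∀ t, 3 * n ^ 2 ≤ t →
        MaxAlg.pow A t = MaxAlg.sum (Finset.Icc 1 m) fun ν => MaxAlg.term A G ν t) := by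
  obtain ⟨m, hmn, hm⟩ := MaxAlg.exists_last_pos hG
  refine ⟨m, hmn, hm, fun ν h1 h2 => MaxAlg.starFinite_pow_normalized ((hm ν h1).mpr h2) _,
    fun t ht μ h1 h2 => MaxAlg.pow_reduced_eq_sum hG hm (by omega) h1 (by omega), fun t ht => ?_⟩
  have h := MaxAlg.pow_reduced_eq_sum hG hm (show 2 * n ^ 2 ≤ t by omega) le_rfl
    (Nat.le_add_left 1 m)
  rwa [MaxAlg.reduced_one] at h
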